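/- Let $p$ be a prime, $q=p^a$ with $a\ge 1$, let $d_1,\dots,d_n\ge 1$ be integers and $d=\operatorname{lcm}(d_1,\dots,d_n)$, and regard the fields $\mathbb F_{q^{d_i}}$ as subfields of $\mathbb F_{q^d}$. Let $K$ be a field with a multiplicative norm that extends the $p$-adic absolute value of $\mathbb Q_p\subseteq K$ (for instance $\mathbb Q_{q^d}(\zeta_p)$, where $\mathbb Q_{q^d}$ is the unramified extension of $\mathbb Q_p$ with residue field $\mathbb F_{q^d}$ and $\zeta_p$ is a primitive $p$-th root of unity), and let $\operatorname{ord}_q$ be the corresponding valuation, normalized by $\operatorname{ord}_q(q)=1$, with $\operatorname{ord}_q(0)=\infty$. Let $\psi$ be a nontrivial additive character of $\mathbb F_{q^d}$ with values in $K$, and let $f\in\mathbb F_{q^d}[x_1,\dots,x_n]$ be a non-constant polynomial. For an integer $b\ge 0$ let $\sigma_p(b)$ be the sum of its base-$p$ digits, and let $w_p(f)$ be the maximum of $\sigma_p(u_1)+\cdots+\sigma_p(u_n)$ over all monomials $x_1^{u_1}\cdots x_n^{u_n}$ that occur in $f$ with non-zero coefficient; assume $w_p(f)\neq 0$, which is the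 same as $f$ being non-constant. (1) Let $0\le r\le n$, let $\omega:\mathbb F_{q^d}\to K$ be a Teichmüller character (a multiplicative map with $\omega(0)=0$, $\omega(1)=1$ whose reduction modulo the maximal ideal of the valuation ring of $K$ is a field embedding of $\mathbb F_{q^d}$ in the residue field), and for $1\le i\le r$ let $\chi_i$ be a multiplicative character of $\mathbb F_{q^{d_i}}^\times$ with values in $K$, trivial or not, with Teichmüller exponent $e_i$, that is, $e_i\in\{1,\dots,q^{d_i}-1\}$ and $\chi_i(x)=\omega(x)^{e_i}$ for all $x\in\mathbb F_{q^{d_i}}^\times$. Put $$S(\chi,\mathbf d,f)=\sum \chi_1(x_1)\cdots\chi_r(x_r)\,\psi(f(x_1,\dots,x_n)),$$ where the sum runs over $x_i\in\mathbb F_{q^{d_i}}^\times$ for $1\le i\le r$ and $x_i\in\mathbb F_{q^{d_i}}$ for $r<i\le n$. Then $$\operatorname{ord}_q S(\chi,\mathbf d,f)\ \ge\ \frac1{w_p(f)}\left(\sum_{i=1}^n d_i-\frac1{a(p-1)}\sum_{i=1}^r\sigma_p(e_i)\right).$$ (2) In the untwisted case, the sum $S(\mathbf d,f)=\sum\psi(f(x_1,\dots,x_n))$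 over all $x_i\in\mathbb F_{q^{d_i}}$, $1\le i\le n$, satisfies $$\operatorname{ord}_q S(\mathbf d,f)\ \ge\ \frac{d_1+\cdots+d_n}{w_p(f)}.$$ -/

import Mathlib

/-- The subfield with `p ^ k` elements of a finite field `F` of characteristic `p` (for `k` dividing
the degree of `F` over its prime field): the elements `x` with `x ^ (p ^ k) = x`. -/
def fixedField (p k : ℕ) [Fact p.Prime] (F : Type*) [Field F] [CharP F p] : Subfield F :=
  (iterateFrobenius F p k).eqLocusField (RingHom.id F)

/-- `σ_p(b)`, the sum of the base-`p` digits of `b`. -/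
def digitSum (p b : ℕ) : ℕ := (Nat.digits p b).sum

/-- The `p`-weight `w_p(f)`: the maximum over the exponents `u` of the monomials of `f` of
`σ_p(u_1) + ⋯ + σ_p(u_n)`. -/
def pWeight (p : ℕ) {n : ℕ} {F : Type*} [CommSemiring F] (f : MvPolynomial (Fin n) F) : ℕ :=
  f.support.sup fun u => ∑ i, digitSum p (u i)

/-- The valuation `ord_q` on a normed extension of `ℚ_[p]`, with `ord_q 0 = ∞`. For `q` a power of
`p` one has `‖q‖ = q⁻¹`, so that `ord_q q = 1`. -/
noncomputable def ordq {K : Type*} [NormedField K] (q : ℕ) (x : K) : WithTop ℝ :=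
  open Classical in if x = 0 then ⊤ else ((-Real.logb q ‖x‖ : ℝ) : WithTop ℝ)

/-- `ω` is a Teichmüller character of the finite field `F` with values in the non-archimedean field
`K`: it is multiplicative (so its values are `0` and roots of unity), and its reduction modulo the
maximal ideal `{‖z‖ < 1}` of the valuation ring is additive, hence a field embedding of `F` in the
residue field of `K`. Thus `ω x` is the root of `z ^ |F| = z` in `K` whose residue is `x`, under
this embedding. -/
def IsTeichmuller {F K : Type*} [Field F] [NormedField K] (ω : F →*₀ K) : Prop :=
  ∀ x y : F, ‖ω (x + y) - (ω x + ω y)‖ < 1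

/-- `e ∈ {1, …, p ^ k - 1}` is the Teichmüller exponent of the multiplicative character `χ` of the
subfield of `F` with `p ^ k` elements: `χ(x) = ω(x) ^ e` on the nonzero elements. -/
def IsTeichmullerExponent {p k : ℕ} [Fact p.Prime] {F K : Type*} [Field F] [CharP F p]
    [NormedField K] (ω : F →*₀ K) (χ : MulChar (fixedField p k F) K) (e : ℕ) : Prop :=
  1 ≤ e ∧ e ≤ p ^ k - 1 ∧ ∀ x : fixedField p k F, x ≠ 0 → χ x = ω (x : F) ^ e

open scoped Classical in
/-- The mixed partial character sum `∑ χ_1(x_1) ⋯ χ_r(x_r) ψ(f(x))`, with `x_i` running over the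
field with `q ^ d_i` elements, `q = p ^ a`, and over its nonzero elements for the first `r`
indices. -/
noncomputable def mixedSum {p : ℕ} [Fact p.Prime] {a n r : ℕ} (hr : r ≤ n) (d : Fin n → ℕ)
    {F K : Type*} [Field F] [Fintype F] [CharP F p] [NormedField K]
    (χ : (i : Fin r) → MulChar (fixedField p (a * d (Fin.castLE hr i)) F) K)
    (ψ : AddChar F K) (f : MvPolynomial (Fin n) F) : K :=
  ∑ x : ((i : Fin n) → fixedField p (a * d i) F) with ∀ i : Fin r, x (Fin.castLE hr i) ≠ 0,
    (∏ i : Fin r, χ i (x (Fin.castLE hr i))) * ψ (MvPolynomial.eval (fun i => (x i : F)) f)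

open scoped Classical in
/-- The partial exponential sum `∑ ψ(f(x))`, with `x_i` running over the field with `q ^ d_i`
elements, `q = p ^ a`. -/
noncomputable def partialSum (p : ℕ) [Fact p.Prime] (a : ℕ) {n : ℕ} (d : Fin n → ℕ)
    {F K : Type*} [Field F] [Fintype F] [CharP F p] [NormedField K]
    (ψ : AddChar F K) (f : MvPolynomial (Fin n) F) : K :=
  ∑ x : ((i : Fin n) → fixedField p (a * d i) F), ψ (MvPolynomial.eval (fun i => (x i : F)) f)

/-! Write ρ = ‖ζ - 1‖ for a primitive p-th root of unity ζ, so that ρ ^ (p - 1) = ‖p‖. By Fourier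
inversion and the upper bound in Stickelberger's theorem, ψ = ∑ c_k ω ^ k with ‖c_k‖ ≤ ρ ^ σ_p(k)
(`exists_expansion_addChar`). Expanding ψ at each monomial u of f separately, with a chosen power
κ_u, turns the character sum into a sum over κ of products of one-variable sums ∑ χ_i(y) ω(y) ^ N_i,
where N_i = ∑ u_i κ_u (`sum_prod_mul_addChar_eval`).

With e = e_i in a twisted variable and e = 0 otherwise, such a sum vanishes unless p ^ k - 1 divides
e + N_i, k = a d_i. If e + N_i > 0, this forces σ_p(e) + σ_p(N_i) ≥ k(p - 1); if e + N_i = 0, the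
sum is p ^ k itself. Since σ_p is subadditive and submultiplicative, ∑ σ_p(N_i) ≤ w_p(f) ∑ σ_p(κ_u),
so the w_p(f)-th power of the coefficient is at most ρ ^ ∑ σ_p(N_i). Multiplying over the variables
bounds each term, and the ultrametric inequality bounds the sum (`norm_weighted_sum_pow_mul_le`). -/

/-! ### Base-p digit sums. -/

section DigitSum

@[simp] lemma digitSum_zero (p : ℕ) : digitSum p 0 = 0 := by simp [digitSum]

lemma digitSum_add_mul {p : ℕ} (hp : 1 < p) {x : ℕ} (hx : x < p) (y : ℕ) :
    digitSum p (x + p * y) = x + digitSum p y := by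
  rcases Nat.eq_zero_or_pos (x + p * y) with h | h
  · have hx0 : x = 0 := by omega
    have hy : y = 0 := by
      have : p * y = 0 := by omega
      rcases Nat.mul_eq_zero.1 this with h | h <;> omega
    simp [hx0, hy]
  · rw [digitSum, Nat.digits_def' hp h, List.sum_cons, digitSum, Nat.add_mul_mod_self_left,
      Nat.mod_eq_of_lt hx, Nat.add_mul_div_left _ _ (by omega), Nat.div_eq_of_lt hx, zero_add]

lemma digitSum_eq_mod_add_div {p : ℕ} (hp : 1 < p) (x : ℕ) :
    digitSum p x = x % p + digitSum p (x / p) := by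
  conv_lhs => rw [← Nat.mod_add_div x p]
  exact digitSum_add_mul hp (Nat.mod_lt _ (by omega)) _

lemma digitSum_base_mul {p : ℕ} (hp : 1 < p) (x : ℕ) : digitSum p (p * x) = digitSum p x := by
  simpa using digitSum_add_mul hp (x := 0) (by omega) x

/-- A carry trades p units in one place for one unit in the next, so it only lowers the digit sum.
-/
lemma digitSum_add_le {p : ℕ} (hp : 1 < p) (x y : ℕ) :
    digitSum p (x + y) ≤ digitSum p x + digitSum p y := by
  induction x using Nat.strong_induction_on generalizing y with
  | _ x ih =>
    have succ_le : ∀ z, digitSum p (z + 1) ≤ digitSum p z + 1 := by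
      intro z
      induction z using Nat.strong_induction_on with
      | _ z ihz =>
        by_cases h : z % p + 1 < p
        · rw [digitSum_eq_mod_add_div hp z]
          have : z + 1 = (z % p + 1) + p * (z / p) := by
            have := Nat.mod_add_div z p; omega
          rw [this, digitSum_add_mul hp h]
          omega
        · have hm := Nat.mod_lt z (show 0 < p by omega)
          have hz := Nat.mod_add_div z p
          have h1 : z + 1 = p * (z / p + 1) := by rw [mul_add]; omega
          rw [h1, digitSum_base_mul hp, digitSum_eq_mod_add_div hp z]
          have := ihz (z / p) (Nat.div_lt_self (by omega) hp)
          omega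
    rcases Nat.eq_zero_or_pos x with rfl | hx
    · simp
    · have e : x + y = (x % p + y % p) + p * (x / p + y / p) := by
        have h1 := Nat.mod_add_div x p
        have h2 := Nat.mod_add_div y p
        rw [mul_add]; omega
      have hmx := Nat.mod_lt x (show 0 < p by omega)
      have hmy := Nat.mod_lt y (show 0 < p by omega)
      have key := ih (x / p) (Nat.div_lt_self hx hp) (y / p)
      rw [e, digitSum_eq_mod_add_div hp x, digitSum_eq_mod_add_div hp y]
      by_cases h : x % p + y % p < p
      · rw [digitSum_add_mul hp h]; omega
      · have : (x % p + y % p) + p * (x / p + y / p) =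
            (x % p + y % p - p) + p * (x / p + y / p + 1) := by
          rw [mul_add p _ 1]; omega
        rw [this, digitSum_add_mul hp (by omega)]
        have := succ_le (x / p + y / p)
        omega

lemma digitSum_sum_le {p : ℕ} (hp : 1 < p) {ι : Type*} (s : Finset ι) (g : ι → ℕ) :
    digitSum p (∑ i ∈ s, g i) ≤ ∑ i ∈ s, digitSum p (g i) :=
  Finset.le_sum_of_subadditive (digitSum p) (digitSum_zero p).le (digitSum_add_le hp) s g

lemma digitSum_mul_le {p : ℕ} (hp : 1 < p) (x y : ℕ) :
    digitSum p (x * y) ≤ digitSum p x * digitSum p y := by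
  induction x using Nat.strong_induction_on with
  | _ x ih =>
    rcases Nat.eq_zero_or_pos x with rfl | hx
    · simp
    · have h1 : x * y = (x % p) * y + p * (x / p * y) := by
        conv_lhs => rw [← Nat.mod_add_div x p]
        ring
      have h2 : digitSum p ((x % p) * y) ≤ (x % p) * digitSum p y := by
        simpa using digitSum_sum_le hp (Finset.range (x % p)) fun _ => y
      calc digitSum p (x * y) ≤ digitSum p ((x % p) * y) + digitSum p (p * (x / p * y)) := by
            rw [h1]; exact digitSum_add_le hp _ _
        _ ≤ (x % p) * digitSum p y + digitSum p (x / p) * digitSum p y := by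
            rw [digitSum_base_mul hp]
            exact add_le_add h2 (ih _ (Nat.div_lt_self hx hp))
        _ = digitSum p x * digitSum p y := by rw [digitSum_eq_mod_add_div hp x, add_mul]

lemma digitSum_add_pow_mul {p : ℕ} (hp : 1 < p) (k : ℕ) {x : ℕ} (hx : x < p ^ k) (y : ℕ) :
    digitSum p (x + p ^ k * y) = digitSum p x + digitSum p y := by
  induction k generalizing x with
  | zero => simp_all
  | succ k ih =>
    have e : x + p ^ (k + 1) * y = x % p + p * (x / p + p ^ k * y) := by
      conv_lhs => rw [← Nat.mod_add_div x p]
      ring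
    rw [e, digitSum_add_mul hp (Nat.mod_lt _ (by omega)), ih, digitSum_eq_mod_add_div hp x]
    · ring
    · rw [Nat.div_lt_iff_lt_mul (by omega), ← pow_succ]; exact hx

/-- All k digits of p ^ k - 1 are p - 1, so x and y have complementary digits. -/
lemma digitSum_add_digitSum_of_add_eq {p : ℕ} (hp : 1 < p) (k : ℕ) {x y : ℕ}
    (h : x + y + 1 = p ^ k) : digitSum p x + digitSum p y = k * (p - 1) := by
  induction k generalizing x y with
  | zero =>
    have hx : x = 0 := by simp at h; omega
    have hy : y = 0 := by simp at h; omega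
    simp [hx, hy]
  | succ k ih =>
    have hmx := Nat.mod_lt x (show 0 < p by omega)
    have hmy := Nat.mod_lt y (show 0 < p by omega)
    have h1 := Nat.mod_add_div x p
    have h2 := Nat.mod_add_div y p
    have e : (x % p + y % p + 1) + p * (x / p + y / p) = p * p ^ k := by
      rw [← pow_succ', ← h, mul_add]; omega
    have hd : p ∣ x % p + y % p + 1 := by
      rw [Nat.dvd_add_iff_left (dvd_mul_right p (x / p + y / p)), e]
      exact dvd_mul_right _ _
    obtain ⟨c, hc⟩ := hd
    have hc1 : c = 1 := by
      have : p * c < p * 2 := by omega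
      have := Nat.lt_of_mul_lt_mul_left this
      have : c ≠ 0 := by rintro rfl; omega
      omega
    have : x / p + y / p + 1 = p ^ k := by
      apply Nat.eq_of_mul_eq_mul_left (show 0 < p by omega)
      rw [← e, hc, hc1]; ring
    have key := ih this
    rw [digitSum_eq_mod_add_div hp x, digitSum_eq_mod_add_div hp y, add_mul]
    subst hc1
    omega

/-- As p ^ k ≡ 1, adding the low k digits to the remaining ones yields a smaller positive multiple
without raising the digit sum. The descent ends at p ^ k - 1. -/
lemma mul_le_digitSum_of_dvd {p : ℕ} (hp : 1 < p) {k : ℕ} (hk : k ≠ 0) {N : ℕ} (hN : 0 < N)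
    (h : p ^ k - 1 ∣ N) : k * (p - 1) ≤ digitSum p N := by
  have hpk : 1 < p ^ k := Nat.one_lt_pow hk hp
  induction N using Nat.strong_induction_on with
  | _ N ih =>
    have hle := Nat.le_of_dvd hN h
    rcases lt_or_ge N (p ^ k) with hlt | hge
    · have := digitSum_add_digitSum_of_add_eq hp k (x := N) (y := 0) (by omega)
      simp at this
      exact this.ge
    · have h1 := Nat.mod_add_div N (p ^ k)
      have hq : 0 < N / p ^ k := Nat.div_pos hge (by omega)
      have hm : p ^ k * (N / p ^ k) = (p ^ k - 1) * (N / p ^ k) + N / p ^ k := by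
        rw [Nat.sub_mul, one_mul, Nat.sub_add_cancel (Nat.le_mul_of_pos_left _ (by omega))]
      have hlt : N % p ^ k + N / p ^ k < N := by
        have : 0 < (p ^ k - 1) * (N / p ^ k) := Nat.mul_pos (by omega) hq
        omega
      have hd : p ^ k - 1 ∣ N % p ^ k + N / p ^ k := by
        have e : (N % p ^ k + N / p ^ k) + (p ^ k - 1) * (N / p ^ k) = N := by omega
        rw [Nat.dvd_add_iff_left (dvd_mul_right (p ^ k - 1) (N / p ^ k)), e]
        exact h
      have hs : digitSum p N = digitSum p (N % p ^ k) + digitSum p (N / p ^ k) := by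
        conv_lhs => rw [← h1]
        exact digitSum_add_pow_mul hp k (Nat.mod_lt _ (by omega)) _
      rw [hs]
      exact (ih _ hlt (Nat.add_pos_right _ hq) hd).trans (digitSum_add_le hp _ _)

end DigitSum

/-! ### Norms on extensions of the p-adic field. -/

section PadicNorm

variable {p : ℕ} [Fact p.Prime] {K : Type*} [NormedField K] [NormedAlgebra ℚ_[p] K]

lemma norm_natCast_eq_padic (n : ℕ) : ‖(n : K)‖ = ‖(n : ℚ_[p])‖ := by
  rw [← map_natCast (algebraMap ℚ_[p] K), norm_algebraMap']

variable (p K) in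
lemma norm_prime_eq : ‖(p : K)‖ = (p : ℝ)⁻¹ := by
  rw [norm_natCast_eq_padic (p := p), Padic.norm_p]

lemma norm_natCast_eq_one_of_coprime {n : ℕ} (h : p.Coprime n) : ‖(n : K)‖ = 1 := by
  rw [norm_natCast_eq_padic (p := p), Padic.norm_natCast_eq_one_iff.2 h]

end PadicNorm

section PadicUltrametric

lemma norm_natCast_le_one_of_padic (p : ℕ) [Fact p.Prime] (K : Type*) [NormedField K]
    [NormedAlgebra ℚ_[p] K] (n : ℕ) : ‖(n : K)‖ ≤ 1 := by
  rw [norm_natCast_eq_padic (p := p)]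
  exact_mod_cast Padic.norm_int_le_one n

lemma isUltrametricDist_of_padic (p : ℕ) [Fact p.Prime] (K : Type*) [NormedField K]
    [NormedAlgebra ℚ_[p] K] : IsUltrametricDist K :=
  IsUltrametricDist.isUltrametricDist_of_forall_norm_natCast_le_one
    (norm_natCast_le_one_of_padic p K)

end PadicUltrametric

section Ultrametric

variable {K : Type*} [NormedField K]

lemma norm_eq_one_of_pow_eq_self {x : K} {n : ℕ} (hn : n ≠ 0) (h : x ^ n = 1) : ‖x‖ = 1 := by
  have : ‖x‖ ^ n = 1 := by rw [← norm_pow, h, norm_one]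
  exact (pow_eq_one_iff_of_nonneg (norm_nonneg x) hn).1 this

variable [IsUltrametricDist K]

variable (K) in
/-- The elements of norm less than one of a non-archimedean field, as an additive subgroup. -/
def openUnitBall : AddSubgroup K :=
  (IsUltrametricDist.ball_openAddSubgroup K zero_lt_one).toAddSubgroup

@[simp] lemma mem_openUnitBall {x : K} : x ∈ openUnitBall K ↔ ‖x‖ < 1 :=
  mem_ball_zero_iff

lemma norm_sum_lt_one {ι : Type*} {s : Finset ι} {g : ι → K} (h : ∀ i ∈ s, ‖g i‖ < 1) :
    ‖∑ i ∈ s, g i‖ < 1 :=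
  mem_openUnitBall.1 (sum_mem fun i hi => mem_openUnitBall.2 (h i hi))

lemma norm_sub_lt_one_trans {x y z : K} (h : ‖x - y‖ < 1) (h' : ‖y - z‖ < 1) : ‖x - z‖ < 1 := by
  rw [← sub_add_sub_cancel x y z]
  exact mem_openUnitBall.1 (add_mem (mem_openUnitBall.2 h) (mem_openUnitBall.2 h'))

lemma norm_eq_of_norm_sub_lt {x y : K} (h : ‖x - y‖ < ‖y‖) : ‖x‖ = ‖y‖ := by
  have := IsUltrametricDist.norm_add_eq_max_of_norm_ne_norm h.ne
  rwa [sub_add_cancel, max_eq_right h.le] at this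

lemma norm_one_sub_pow_le {ζ : K} (hζ : ‖ζ‖ ≤ 1) (n : ℕ) : ‖1 - ζ ^ n‖ ≤ ‖1 - ζ‖ := by
  rw [← mul_neg_geom_sum, norm_mul]
  refine mul_le_of_le_one_right (norm_nonneg _) ?_
  refine IsUltrametricDist.norm_sum_le_of_forall_le_of_nonneg zero_le_one fun i _ => ?_
  rw [norm_pow]
  exact pow_le_one₀ (norm_nonneg _) hζ

end Ultrametric

/-! ### The norm of ζ - 1. -/

section PrimitiveRoot

lemma IsPrimitiveRoot.norm_sub_one_pos {p : ℕ} [hp : Fact p.Prime] {K : Type*} [NormedField K]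
    {ζ : K} (hζ : IsPrimitiveRoot ζ p) : 0 < ‖ζ - 1‖ := by
  rw [norm_pos_iff, sub_ne_zero]
  exact hζ.ne_one hp.out.one_lt

variable {p : ℕ} [hp : Fact p.Prime] {K : Type*} [NormedField K] [NormedAlgebra ℚ_[p] K]

/-- The product of the 1 - ζ ^ j over 0 < j < p is p, and all factors have equal norm because ζ and
ζ ^ j are powers of each other. -/
lemma IsPrimitiveRoot.norm_sub_one_pow_of_padic {ζ : K} (hζ : IsPrimitiveRoot ζ p) :
    ‖ζ - 1‖ ^ (p - 1) = (p : ℝ)⁻¹ := by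
  have := isUltrametricDist_of_padic p K
  have h1 : ‖ζ‖ = 1 := norm_eq_one_of_pow_eq_self hp.out.ne_zero hζ.pow_eq_one
  have hp1 : p - 1 + 1 = p := Nat.sub_add_cancel hp.out.one_le
  have key := IsPrimitiveRoot.prod_one_sub_pow_eq_order (n := p - 1) (μ := ζ) (by rwa [hp1])
  have hcast : ((p - 1 : ℕ) : K) + 1 = p := by exact_mod_cast congrArg (Nat.cast (R := K)) hp1
  rw [hcast] at key
  have hterm : ∀ k ∈ Finset.range (p - 1), ‖1 - ζ ^ (k + 1)‖ = ‖1 - ζ‖ := by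
    intro k hk
    have hk' : k + 1 < p := by have := Finset.mem_range.1 hk; omega
    refine le_antisymm (norm_one_sub_pow_le h1.le _) ?_
    have hcop : (k + 1).Coprime p :=
      ((Nat.Prime.coprime_iff_not_dvd hp.out).2 (Nat.not_dvd_of_pos_of_lt k.succ_pos hk')).symm
    obtain ⟨m, -, hm⟩ := Nat.exists_mul_mod_eq_one_of_coprime hcop hp.out.one_lt
    have : (ζ ^ (k + 1)) ^ m = ζ := by
      rw [← pow_mul, ← Nat.mod_add_div ((k + 1) * m) p, hm, pow_add, pow_mul, hζ.pow_eq_one]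
      simp
    conv_lhs => rw [← this]
    exact norm_one_sub_pow_le (by rw [norm_pow, h1, one_pow]) m
  have hn := congrArg norm key
  rw [norm_prod, Finset.prod_congr rfl hterm, Finset.prod_const, Finset.card_range,
    norm_prime_eq p K] at hn
  rw [norm_sub_rev, hn]

lemma IsPrimitiveRoot.norm_sub_one_lt_one {ζ : K} (hζ : IsPrimitiveRoot ζ p) : ‖ζ - 1‖ < 1 := by
  by_contra! h
  have h1 := one_le_pow₀ h (n := p - 1)
  rw [hζ.norm_sub_one_pow_of_padic] at h1
  exact absurd h1 (not_le.2 (inv_lt_one_of_one_lt₀ (by exact_mod_cast hp.out.one_lt)))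

lemma IsPrimitiveRoot.norm_prime_pow {ζ : K} (hζ : IsPrimitiveRoot ζ p) (m : ℕ) :
    ‖((p ^ m : ℕ) : K)‖ = ‖ζ - 1‖ ^ (m * (p - 1)) := by
  rw [Nat.cast_pow, norm_pow, norm_prime_eq p K, ← hζ.norm_sub_one_pow_of_padic, ← pow_mul,
    mul_comm]

end PrimitiveRoot

/-! ### Additive characters of a finite field. -/

section TraceChar

variable {p : ℕ} [hp : Fact p.Prime] {F K : Type*} [Field F] [Algebra (ZMod p) F] [Field K]

variable (F) in
/-- The additive character `x ↦ ζ ^ Tr x` of a finite field of characteristic `p`, for a `p`-th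
root of unity `ζ`. -/
noncomputable def traceChar {ζ : K} (hζ : ζ ^ p = 1) : AddChar F K :=
  (AddChar.zmodChar p hζ).compAddMonoidHom (Algebra.trace (ZMod p) F).toAddMonoidHom

lemma traceChar_apply {ζ : K} (hζ : ζ ^ p = 1) (x : F) :
    traceChar F hζ x = ζ ^ (Algebra.trace (ZMod p) F x).val := rfl

lemma exists_isPrimitiveRoot_of_addChar {ψ : AddChar F K} (hψ : ψ ≠ 1) :
    ∃ ζ : K, IsPrimitiveRoot ζ p := by
  obtain ⟨x, hx⟩ := AddChar.ne_one_iff.1 hψ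
  have := charP_of_injective_algebraMap (algebraMap (ZMod p) F).injective p
  refine ⟨ψ x, IsPrimitiveRoot.iff_orderOf.2 (orderOf_eq_prime ?_ hx)⟩
  rw [← AddChar.map_nsmul_eq_pow, nsmul_eq_mul, CharP.cast_eq_zero, zero_mul,
    AddChar.map_zero_eq_one]

variable [Finite F]

lemma algebra_trace_pow_char (x : F) :
    Algebra.trace (ZMod p) F (x ^ p) = Algebra.trace (ZMod p) F x := by
  have := Algebra.trace_eq_of_algEquiv (FiniteField.frobeniusAlgEquivOfAlgebraic (ZMod p) F) x
  simpa using this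

lemma traceChar_pow_char {ζ : K} (hζ : ζ ^ p = 1) (x : F) :
    traceChar F hζ (x ^ p) = traceChar F hζ x := by
  rw [traceChar_apply, traceChar_apply, algebra_trace_pow_char]

lemma traceChar_ne_one {ζ : K} (hζ : IsPrimitiveRoot ζ p) : traceChar F hζ.pow_eq_one ≠ 1 := by
  obtain ⟨x, hx⟩ := Algebra.trace_surjective (ZMod p) F 1
  intro h
  have h1 := DFunLike.congr_fun h x
  rw [traceChar_apply, hx, AddChar.one_apply, ZMod.val_one, pow_one] at h1
  exact hζ.ne_one hp.out.one_lt h1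

/-- The shifts of Ψ are |F| distinct characters; one more would give |F| + 1 independent functions
on F. -/
lemma AddChar.exists_eq_mulShift {Ψ : AddChar F K} (hΨ : Ψ ≠ 1) (ψ : AddChar F K) :
    ∃ c : F, ψ = Ψ.mulShift c := by
  classical
  have := Fintype.ofFinite F
  by_contra! h
  let v : Option F → (Multiplicative F →* K) := fun o =>
    AddChar.toMonoidHomEquiv (o.elim ψ Ψ.mulShift)
  have hv : Function.Injective v := by
    have hinj := AddChar.to_mulShift_inj_of_isPrimitive (AddChar.IsPrimitive.of_ne_one hΨ)
    refine AddChar.toMonoidHomEquiv.injective.comp ?_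
    rintro (_ | x) (_ | y) hxy
    · rfl
    · exact absurd hxy (h y)
    · exact absurd hxy.symm (h x)
    · exact congrArg some (hinj hxy)
  have hli := (linearIndependent_monoidHom (Multiplicative F) K).comp v hv
  have hcard := hli.fintype_card_le_finrank
  rw [Fintype.card_option, Module.finrank_fintype_fun_eq_card, Fintype.card_multiplicative]
    at hcard
  omega

end TraceChar

/-! ### Teichmüller and multiplicative characters. -/

section Teichmuller

variable {F K : Type*} [Field F] [NormedField K] {ω : F →*₀ K}

lemma norm_of_map_ne_zero [Finite F] {x : F} (hx : x ≠ 0) : ‖ω x‖ = 1 := by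
  have := Fintype.ofFinite F
  have h1 : 1 < Fintype.card F := Fintype.one_lt_card
  refine norm_eq_one_of_pow_eq_self (n := Fintype.card F - 1) (by omega) ?_
  rw [← map_pow, FiniteField.pow_card_sub_one_eq_one x hx, map_one]

lemma norm_map_le_one [Finite F] (x : F) : ‖ω x‖ ≤ 1 := by
  rcases eq_or_ne x 0 with rfl | hx
  · simp
  · exact (norm_of_map_ne_zero hx).le

namespace IsTeichmuller

lemma injective [Finite F] (hω : IsTeichmuller ω) : Function.Injective ω := by
  intro x y hxy
  by_contra hne
  have h := hω (x - y) y
  rw [sub_add_cancel, hxy, sub_add_cancel_right, norm_neg,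
    norm_of_map_ne_zero (sub_ne_zero.2 hne)] at h
  exact lt_irrefl _ h

variable [IsUltrametricDist K]

lemma norm_map_sum_sub (hω : IsTeichmuller ω) {ι : Type*} (s : Finset ι) (g : ι → F) :
    ‖ω (∑ i ∈ s, g i) - ∑ i ∈ s, ω (g i)‖ < 1 := by
  classical
  induction s using Finset.induction_on with
  | empty => simp
  | insert i s hi ih =>
    rw [Finset.sum_insert hi, Finset.sum_insert hi]
    refine norm_sub_lt_one_trans (hω _ _) ?_
    rwa [add_sub_add_left_eq_sub]

lemma norm_map_natCast_sub (hω : IsTeichmuller ω) (n : ℕ) : ‖ω (n : F) - n‖ < 1 := by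
  simpa using hω.norm_map_sum_sub (Finset.range n) fun _ => (1 : F)

end IsTeichmuller

end Teichmuller

section MulChar

variable {F K : Type*} [Field F] [NormedField K]

lemma MulChar.norm_le_one [Finite F] (χ : MulChar F K) (x : F) : ‖χ x‖ ≤ 1 := by
  have := Fintype.ofFinite F
  rcases eq_or_ne x 0 with rfl | hx
  · simp
  · have h1 : 1 < Fintype.card F := Fintype.one_lt_card
    refine (norm_eq_one_of_pow_eq_self (n := Fintype.card F - 1) (by omega) ?_).le
    rw [← map_pow, FiniteField.pow_card_sub_one_eq_one x hx, map_one]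

lemma norm_jacobiSum_le_one [Fintype F] [IsUltrametricDist K] (χ φ : MulChar F K) :
    ‖jacobiSum χ φ‖ ≤ 1 := by
  refine IsUltrametricDist.norm_sum_le_of_forall_le_of_nonneg zero_le_one fun x _ => ?_
  rw [norm_mul]
  exact mul_le_one₀ (χ.norm_le_one _) (norm_nonneg _) (φ.norm_le_one _)

/-- The inverse of a multiplicative map `ω`, as a multiplicative character. -/
noncomputable def invMulChar (ω : F →*₀ K) : MulChar F K :=
  (⟨(ω : F →* K), fun x hx => by
    rw [isUnit_iff_ne_zero, not_not] at hx
    simp [hx]⟩ : MulChar F K)⁻¹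

lemma invMulChar_apply (ω : F →*₀ K) (x : F) : invMulChar ω x = ω x⁻¹ :=
  MulChar.inv_apply' _ x

lemma invMulChar_pow_apply (ω : F →*₀ K) (k : ℕ) {x : F} (hx : x ≠ 0) :
    (invMulChar ω ^ k) x = ω x⁻¹ ^ k := by
  rw [← invMulChar_apply]
  exact MulChar.pow_apply_coe (invMulChar ω) k (Units.mk0 x hx)

variable [Fintype F] {ω : F →*₀ K}

lemma IsTeichmuller.invMulChar_pow_eq_one_iff (hω : IsTeichmuller ω) (k : ℕ) :
    invMulChar ω ^ k = 1 ↔ Fintype.card F - 1 ∣ k := by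
  rw [← FiniteField.forall_pow_eq_one_iff, MulChar.eq_one_iff]
  constructor
  · intro h x
    have h1 := h x⁻¹
    rw [invMulChar_pow_apply _ _ (Units.ne_zero _), Units.val_inv_eq_inv_val, inv_inv,
      ← map_pow, ← map_one ω] at h1
    exact Units.ext (by simpa using hω.injective h1)
  · intro h x
    rw [invMulChar_pow_apply _ _ (Units.ne_zero _), ← map_pow, ← Units.val_inv_eq_inv_val,
      ← Units.val_pow_eq_pow_val, h, Units.val_one, map_one]

end MulChar

/-! ### Gauss sums and Stickelberger's bounds. -/

section GaussSum

variable {p : ℕ} [hp : Fact p.Prime] {F K : Type*} [Field F] [Fintype F] [Algebra (ZMod p) F]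
  [NormedField K] {ω : F →*₀ K} {ζ : K}

lemma gaussSum_invMulChar_pow_mul_char (ω : F →*₀ K) (hζ : ζ ^ p = 1) (k : ℕ) :
    gaussSum (invMulChar ω ^ (p * k)) (traceChar F hζ) =
      gaussSum (invMulChar ω ^ k) (traceChar F hζ) := by
  have := charP_of_injective_algebraMap (algebraMap (ZMod p) F).injective p
  have hbij : Function.Bijective fun x : F => x ^ p := bijective_frobenius F p
  refine Fintype.sum_bijective _ hbij _ _ fun x => ?_
  rw [traceChar_pow_char, map_pow, pow_mul', MulChar.pow_apply' _ hp.out.ne_zero]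

/-- In Tr x = ∑ x ^ (p ^ j) the term j = 0 contributes |F| - 1 = -1; the others give power sums of
exponent below |F| - 1, which vanish. -/
lemma sum_inv_mul_trace :
    ∑ x : F, x⁻¹ * algebraMap (ZMod p) F (Algebra.trace (ZMod p) F x) = -1 := by
  have hcard : Fintype.card F = p ^ Module.finrank (ZMod p) F := by
    rw [Module.card_eq_pow_finrank (K := ZMod p), ZMod.card]
  have hfin : 0 < Module.finrank (ZMod p) F := Module.finrank_pos
  simp_rw [FiniteField.algebraMap_trace_eq_sum_pow, Finset.mul_sum, Nat.card_zmod]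
  rw [Finset.sum_comm, Finset.sum_eq_single_of_mem 0 (Finset.mem_range.2 hfin)]
  · classical
    have h1 : ∀ x : F, x⁻¹ * x ^ p ^ 0 = 1 - if x = 0 then 1 else 0 := by
      intro x
      rcases eq_or_ne x 0 with rfl | hx
      · simp
      · simp [hx]
    simp_rw [h1]
    simp
  · intro j hj hj0
    have hpj : 1 < p ^ j := Nat.one_lt_pow hj0 hp.out.one_lt
    have h1 : ∀ x : F, x⁻¹ * x ^ p ^ j = x ^ (p ^ j - 1) := by
      intro x
      rcases eq_or_ne x 0 with rfl | hx
      · rw [inv_zero, zero_mul, zero_pow (by omega)]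
      · rw [pow_sub₀ _ hx hpj.le, pow_one, mul_comm]
    simp_rw [h1]
    refine FiniteField.sum_pow_lt_card_sub_one F _ ?_
    have : p ^ j < Fintype.card F := by
      rw [hcard]
      exact Nat.pow_lt_pow_right hp.out.one_lt (Finset.mem_range.1 hj)
    omega

variable [NormedAlgebra ℚ_[p] K]

/-- Subtracting ∑ ω(x)⁻¹ = 0 lets ζ - 1 be factored out of each ζ ^ t - 1, with cofactor congruent
to t. The quotient reduces to ∑ x⁻¹ Tr x = -1, so it has norm one. -/
lemma norm_gaussSum_invMulChar (hω : IsTeichmuller ω) (hζ : IsPrimitiveRoot ζ p)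
    (hF : 2 < Fintype.card F) :
    ‖gaussSum (invMulChar ω) (traceChar F hζ.pow_eq_one)‖ = ‖ζ - 1‖ := by
  have := isUltrametricDist_of_padic p K
  have := charP_of_injective_algebraMap (algebraMap (ZMod p) F).injective p
  have hζ1 : ‖ζ - 1‖ < 1 := hζ.norm_sub_one_lt_one
  have hζn : ‖ζ‖ = 1 := norm_eq_one_of_pow_eq_self hp.out.ne_zero hζ.pow_eq_one
  have hne : invMulChar ω ≠ 1 := by
    rw [← pow_one (invMulChar ω), Ne, hω.invMulChar_pow_eq_one_iff]
    intro h
    have := Nat.le_of_dvd one_pos h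
    omega
  set t : F → ℕ := fun x => (Algebra.trace (ZMod p) F x).val with ht
  set h : F → K := fun x => ∑ i ∈ Finset.range (t x), ζ ^ i with hh
  have hdecomp : gaussSum (invMulChar ω) (traceChar F hζ.pow_eq_one) =
      (ζ - 1) * ∑ x, invMulChar ω x * h x := by
    have e : ∀ x, invMulChar ω x * traceChar F hζ.pow_eq_one x =
        invMulChar ω x + (ζ - 1) * (invMulChar ω x * h x) := by
      intro x
      have : (ζ - 1) * h x = ζ ^ t x - 1 := mul_geom_sum ζ (t x)
      rw [traceChar_apply, mul_left_comm, this]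
      ring
    rw [gaussSum, Finset.sum_congr rfl fun x _ => e x, Finset.sum_add_distrib,
      MulChar.sum_eq_zero_of_ne_one hne, zero_add, Finset.mul_sum]
  have hcast : ∀ x, ((t x : ℕ) : F) = algebraMap (ZMod p) F (Algebra.trace (ZMod p) F x) := by
    intro x
    rw [← map_natCast (algebraMap (ZMod p) F), ht, ZMod.natCast_zmod_val]
  have hh' : ∀ x, ‖h x - ω (t x : F)‖ < 1 := by
    intro x
    refine norm_sub_lt_one_trans (y := (t x : K)) ?_ ?_
    · have : h x - t x = ∑ i ∈ Finset.range (t x), (ζ ^ i - 1) := by simp [hh]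
      rw [this]
      refine norm_sum_lt_one fun i _ => ?_
      rw [norm_sub_rev]
      refine (norm_one_sub_pow_le hζn.le i).trans_lt ?_
      rwa [norm_sub_rev]
    · rw [norm_sub_rev]
      exact hω.norm_map_natCast_sub _
  have hsum : ‖(∑ x, invMulChar ω x * h x) - ω (∑ x : F, x⁻¹ * (t x : F))‖ < 1 := by
    refine norm_sub_lt_one_trans (y := ∑ x : F, ω (x⁻¹ * (t x : F))) ?_ ?_
    · rw [← Finset.sum_sub_distrib]
      refine norm_sum_lt_one fun x _ => ?_
      rw [invMulChar_apply, map_mul, ← mul_sub, norm_mul]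
      exact (mul_le_of_le_one_left (norm_nonneg _) (norm_map_le_one _)).trans_lt (hh' x)
    · rw [norm_sub_rev]
      exact hω.norm_map_sum_sub _ _
  simp_rw [hcast] at hsum
  rw [sum_inv_mul_trace] at hsum
  have hone : ‖ω (-1 : F)‖ = 1 := norm_of_map_ne_zero (neg_ne_zero.2 one_ne_zero)
  rw [hdecomp, norm_mul, norm_eq_of_norm_sub_lt (hsum.trans_eq hone.symm), hone, mul_one]

/-- A zero last digit is removed by Frobenius invariance. Otherwise g(k) J = g(k - 1) g(1) with a
Jacobi sum J of norm at most one, which lowers the last digit by one. -/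
lemma pow_digitSum_le_norm_gaussSum (hω : IsTeichmuller ω) (hζ : IsPrimitiveRoot ζ p) {k : ℕ}
    (hk : k < Fintype.card F - 1) :
    ‖ζ - 1‖ ^ digitSum p k ≤
      ‖gaussSum (invMulChar ω ^ k) (traceChar F hζ.pow_eq_one)‖ := by
  have := isUltrametricDist_of_padic p K
  have hp1 := hp.out.one_lt
  induction k using Nat.strong_induction_on with
  | _ k ih =>
    rcases Nat.eq_zero_or_pos k with rfl | hk0
    · rw [pow_zero, gaussSum_one_left (traceChar_ne_one hζ)]
      simp
    by_cases hd : p ∣ k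
    · obtain ⟨m, rfl⟩ := hd
      have hm : 0 < m := Nat.pos_of_mul_pos_left hk0
      have hlt : m < p * m := (Nat.lt_mul_iff_one_lt_left hm).2 hp1
      rw [digitSum_base_mul hp1, gaussSum_invMulChar_pow_mul_char]
      exact ih m hlt (hlt.trans hk)
    · obtain ⟨m, rfl⟩ : ∃ m, k = m + 1 := ⟨k - 1, by omega⟩
      have hjac := jacobiSum_mul_nontrivial (χ := invMulChar ω ^ m) (φ := invMulChar ω)
        (by
          rw [← pow_succ, Ne, hω.invMulChar_pow_eq_one_iff]
          exact fun h => absurd (Nat.le_of_dvd hk0 h) (by omega)) (traceChar F hζ.pow_eq_one)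
      rw [← pow_succ] at hjac
      have hle : digitSum p (m + 1) = digitSum p m + 1 := by
        have h1 : (m + 1) % p ≠ 0 := fun h => hd (Nat.dvd_of_mod_eq_zero h)
        have h2 := Nat.mod_add_div (m + 1) p
        have h3 := Nat.mod_lt (m + 1) (show 0 < p by omega)
        have h4 : m = ((m + 1) % p - 1) + p * ((m + 1) / p) := by omega
        rw [digitSum_eq_mod_add_div hp1 (m + 1)]
        conv_rhs => rw [h4]
        rw [digitSum_add_mul hp1 (by omega)]
        omega
      calc ‖ζ - 1‖ ^ digitSum p (m + 1)
          = ‖ζ - 1‖ ^ digitSum p m * ‖ζ - 1‖ := by rw [hle, pow_succ]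
        _ ≤ ‖gaussSum (invMulChar ω ^ m) (traceChar F hζ.pow_eq_one)‖ *
            ‖gaussSum (invMulChar ω) (traceChar F hζ.pow_eq_one)‖ := by
            rw [norm_gaussSum_invMulChar hω hζ (by omega)]
            exact mul_le_mul_of_nonneg_right (ih m (by omega) (by omega)) (norm_nonneg _)
        _ = ‖gaussSum (invMulChar ω ^ (m + 1)) (traceChar F hζ.pow_eq_one)‖ *
            ‖jacobiSum (invMulChar ω ^ m) (invMulChar ω)‖ := by
            rw [← norm_mul, ← norm_mul, hjac]
        _ ≤ _ := mul_le_of_le_one_right (norm_nonneg _) (norm_jacobiSum_le_one _ _)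

lemma norm_gaussSum_mul_norm_gaussSum {χ : MulChar F K} (hχ : χ ≠ 1) {ψ : AddChar F K}
    (hψ : ψ ≠ 1) : ‖gaussSum χ ψ‖ * ‖gaussSum χ⁻¹ ψ‖ = ‖(Fintype.card F : K)‖ := by
  have h := gaussSum_mul_gaussSum_eq_card hχ (AddChar.IsPrimitive.of_ne_one hψ)
  have h2 := mul_gaussSum_inv_eq_gaussSum χ⁻¹ ψ
  have h3 : ‖χ⁻¹ (-1)‖ = 1 := by
    refine norm_eq_one_of_pow_eq_self two_ne_zero ?_
    rw [← map_pow, neg_one_sq, map_one]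
  rw [← h2, norm_mul, h3, one_mul, ← norm_mul, h]

/-- For k > 0, the norms at k and l = |F| - 1 - k multiply to ‖|F|‖ = ρ ^ (σ_p(k) + σ_p(l)), so the
lower bound at l is an upper bound at k. -/
lemma norm_gaussSum_le_pow_digitSum (hω : IsTeichmuller ω) (hζ : IsPrimitiveRoot ζ p) {k : ℕ}
    (hk : k < Fintype.card F - 1) {ψ : AddChar F K} (hψ : ψ ≠ 1) :
    ‖gaussSum (invMulChar ω ^ k) ψ‖ ≤ ‖ζ - 1‖ ^ digitSum p k := by
  have hp1 := hp.out.one_lt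
  obtain ⟨c, hc⟩ := AddChar.exists_eq_mulShift (traceChar_ne_one (F := F) hζ) ψ
  have hc0 : c ≠ 0 := by
    rintro rfl
    exact hψ (by rw [hc, AddChar.mulShift_zero])
  have hshift := gaussSum_mulShift_eq (invMulChar ω ^ k) (traceChar F hζ.pow_eq_one)
    (Units.mk0 c hc0)
  have hle : ‖gaussSum (invMulChar ω ^ k) ψ‖ ≤
      ‖gaussSum (invMulChar ω ^ k) (traceChar F hζ.pow_eq_one)‖ := by
    rw [hc]
    rw [Units.val_mk0] at hshift
    rw [hshift, norm_mul]
    exact mul_le_of_le_one_left (norm_nonneg _) (MulChar.norm_le_one _ _)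
  refine hle.trans ?_
  rcases Nat.eq_zero_or_pos k with rfl | hk0
  · rw [pow_zero, gaussSum_one_left (traceChar_ne_one hζ)]
    simp
  obtain ⟨m, hm⟩ : ∃ m, Fintype.card F = p ^ m :=
    ⟨_, by rw [Module.card_eq_pow_finrank (K := ZMod p), ZMod.card]⟩
  set l := Fintype.card F - 1 - k with hl
  have hinv : (invMulChar ω ^ k)⁻¹ = invMulChar ω ^ l := by
    refine inv_eq_of_mul_eq_one_right ?_
    rw [← pow_add, hω.invMulChar_pow_eq_one_iff, hl, Nat.add_sub_cancel' hk.le]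
  have hprod := norm_gaussSum_mul_norm_gaussSum (χ := invMulChar ω ^ k)
    (by
      rw [Ne, hω.invMulChar_pow_eq_one_iff]
      exact fun h => absurd (Nat.le_of_dvd hk0 h) (by omega)) (traceChar_ne_one (F := F) hζ)
  rw [hinv, hm, hζ.norm_prime_pow,
    ← digitSum_add_digitSum_of_add_eq hp1 m (x := k) (y := l) (by omega), pow_add] at hprod
  have hlow := pow_digitSum_le_norm_gaussSum hω hζ (k := l) (by omega)
  have hpos : 0 < ‖ζ - 1‖ ^ digitSum p l := pow_pos hζ.norm_sub_one_pos _
  refine le_of_mul_le_mul_right ?_ hpos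
  rw [← hprod]
  exact mul_le_mul_of_nonneg_left hlow (norm_nonneg _)

end GaussSum

/-! ### Expansion of ψ in powers of ω. -/

section Expansion

variable {p : ℕ} [hp : Fact p.Prime] {F K : Type*} [Field F] [Fintype F] [Algebra (ZMod p) F]
  [NormedField K] [NormedAlgebra ℚ_[p] K] {ω : F →*₀ K} {ζ : K}

lemma sum_gaussSum_mul_pow (hω : IsTeichmuller ω) (ψ : AddChar F K) {x : F} (hx : x ≠ 0) :
    ∑ k ∈ Finset.range (Fintype.card F - 1), gaussSum (invMulChar ω ^ k) ψ * ω x ^ k =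
      ((Fintype.card F - 1 : ℕ) : K) * ψ x := by
  classical
  simp_rw [gaussSum, Finset.sum_mul]
  rw [Finset.sum_comm, Finset.sum_eq_single_of_mem x (Finset.mem_univ _)]
  · have : ∀ k ∈ Finset.range (Fintype.card F - 1),
        (invMulChar ω ^ k) x * ψ x * ω x ^ k = ψ x := by
      intro k _
      rw [invMulChar_pow_apply _ _ hx, mul_right_comm, ← mul_pow, ← map_mul,
        inv_mul_cancel₀ hx, map_one, one_pow, one_mul]
    rw [Finset.sum_congr rfl this, Finset.sum_const, Finset.card_range, nsmul_eq_mul]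
  · intro y _ hyx
    rcases eq_or_ne y 0 with rfl | hy
    · refine Finset.sum_eq_zero fun k _ => ?_
      rw [MulChar.map_zero, zero_mul, zero_mul]
    · have : ∀ k ∈ Finset.range (Fintype.card F - 1),
          (invMulChar ω ^ k) y * ψ y * ω x ^ k = ψ y * ω (y⁻¹ * x) ^ k := by
        intro k _
        rw [invMulChar_pow_apply _ _ hy, map_mul, mul_pow]
        ring
      rw [Finset.sum_congr rfl this, ← Finset.mul_sum]
      have hz : y⁻¹ * x ≠ 0 := mul_ne_zero (inv_ne_zero hy) hx
      have hne : ω (y⁻¹ * x) - 1 ≠ 0 := by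
        rw [sub_ne_zero, ← map_one ω]
        intro h
        have := hω.injective h
        rw [inv_mul_eq_one₀ hy] at this
        exact hyx this
      have hgeom := mul_geom_sum (ω (y⁻¹ * x)) (Fintype.card F - 1)
      rw [← map_pow, FiniteField.pow_card_sub_one_eq_one _ hz, map_one, sub_self] at hgeom
      rw [(mul_eq_zero.1 hgeom).resolve_left hne, mul_zero]

/-- An additive character of a finite field is a polynomial in the Teichmüller character, whose
coefficients are bounded in terms of the digit sums of the exponents (Stickelberger). -/
lemma exists_expansion_addChar (hω : IsTeichmuller ω) (hζ : IsPrimitiveRoot ζ p)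
    {ψ : AddChar F K} (hψ : ψ ≠ 1) :
    ∃ c : ℕ → K, (∀ x, ψ x = ∑ k ∈ Finset.range (Fintype.card F), c k * ω x ^ k) ∧
      ∀ k ∈ Finset.range (Fintype.card F), ‖c k‖ ≤ ‖ζ - 1‖ ^ digitSum p k := by
  classical
  have := isUltrametricDist_of_padic p K
  have hp1 := hp.out.one_lt
  have hQ : 1 < Fintype.card F := Fintype.one_lt_card
  obtain ⟨m, hm⟩ : ∃ m, Fintype.card F = p ^ m :=
    ⟨_, by rw [Module.card_eq_pow_finrank (K := ZMod p), ZMod.card]⟩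
  set N := Fintype.card F - 1 with hN
  have hQN : Fintype.card F = N + 1 := by omega
  have hcop : p.Coprime N := by
    have hm0 : m ≠ 0 := by rintro rfl; simp at hm; omega
    refine (Nat.Prime.coprime_iff_not_dvd hp.out).2 fun h => ?_
    have h1 : p ∣ N + 1 := by rw [← hQN, hm]; exact dvd_pow_self p hm0
    exact hp.out.one_lt.ne' (Nat.dvd_one.1 ((Nat.dvd_add_right h).1 h1))
  have hN1 : ‖(N : K)‖ = 1 := norm_natCast_eq_one_of_coprime hcop
  have hN0 : (N : K) ≠ 0 := norm_ne_zero_iff.1 (by rw [hN1]; exact one_ne_zero)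
  have hNpos : N ≠ 0 := by omega
  set b : ℕ → K := fun k => (N : K)⁻¹ * gaussSum (invMulChar ω ^ k) ψ with hb
  have hb0 : b 0 = -(N : K)⁻¹ := by
    simp only [hb]
    rw [pow_zero, gaussSum_one_left hψ, mul_neg_one]
  have hbsum : ∀ x ≠ 0, ∑ k ∈ Finset.range N, b k * ω x ^ k = ψ x := by
    intro x hx
    simp_rw [hb, mul_assoc]
    rw [← Finset.mul_sum, sum_gaussSum_mul_pow hω ψ hx, inv_mul_cancel_left₀ hN0]
  -- The Fourier expansion holds only for x ≠ 0; at 0 it gives b 0 instead of 1. As ω ^ 0 and ω ^ N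
  -- agree off 0, the excess b 0 - 1 = -|F| / N moves to ω ^ N, and its norm is exactly ρ ^ σ_p(N).
  set c : ℕ → K := fun k => if k = 0 then 1 else if k = N then b 0 - 1 else b k with hc
  refine ⟨c, fun x => ?_, fun k hk => ?_⟩
  · rw [hQN, Finset.sum_range_succ]
    have hcN : c N = b 0 - 1 := by simp [hc, hNpos]
    have hck : ∀ k ∈ Finset.range N, c k * ω x ^ k =
        b k * ω x ^ k + if k = 0 then 1 - b 0 else 0 := by
      intro k hk
      have hkN : k ≠ N := (Finset.mem_range.1 hk).ne
      by_cases hk0 : k = 0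
      · simp [hc, hk0]
      · simp [hc, hk0, hkN]
    rw [Finset.sum_congr rfl hck, Finset.sum_add_distrib, Finset.sum_ite_eq' (Finset.range N) 0,
      if_pos (Finset.mem_range.2 (Nat.pos_of_ne_zero hNpos)), hcN]
    rcases eq_or_ne x 0 with rfl | hx
    · have : ∑ k ∈ Finset.range N, b k * ω (0 : F) ^ k = b 0 := by
        rw [Finset.sum_eq_single_of_mem 0 (Finset.mem_range.2 (Nat.pos_of_ne_zero hNpos))]
        · simp
        · intro k _ hk
          simp [hk]
      rw [this, AddChar.map_zero_eq_one, map_zero, zero_pow hNpos]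
      ring
    · rw [hbsum x hx, ← map_pow, FiniteField.pow_card_sub_one_eq_one x hx, map_one]
      ring
  · by_cases hk0 : k = 0
    · simp [hc, hk0]
    by_cases hkN : k = N
    · have hcN : c k = -((N : K)⁻¹ * (Fintype.card F : K)) := by
        simp only [hc, if_neg hk0, if_pos hkN, hb0, hQN]
        push_cast
        field_simp
        ring
      have hdig := digitSum_add_digitSum_of_add_eq hp1 m (x := N) (y := 0) (by omega)
      rw [digitSum_zero, add_zero] at hdig
      rw [hcN, norm_neg, norm_mul, norm_inv, hN1, inv_one, one_mul, hm, hζ.norm_prime_pow, hkN,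
        hdig]
    · have hck : c k = b k := by simp [hc, hk0, hkN]
      have hlt : k < Fintype.card F - 1 := by
        have := Finset.mem_range.1 hk; omega
      rw [hck, hb, norm_mul, norm_inv, hN1, inv_one, one_mul]
      exact norm_gaussSum_le_pow_digitSum hω hζ hlt hψ

end Expansion

/-! ### Cardinality of the subfields. -/

section FixedField

variable {p : ℕ} [hp : Fact p.Prime] {F : Type*} [Field F] [CharP F p]

lemma mem_fixedField {k : ℕ} {x : F} : x ∈ fixedField p k F ↔ x ^ p ^ k = x := by
  rw [fixedField, RingHom.mem_eqLocusField, iterateFrobenius_def, RingHom.id_apply]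

/-- The exponent of the unit group gives the upper bound; an embedding of `GaloisField p k`,
available as k ∣ m, gives the lower one. -/
lemma card_fixedField [Fintype F] {k m : ℕ} (hk : k ≠ 0) (hF : Fintype.card F = p ^ m)
    (hkm : k ∣ m) [Fintype (fixedField p k F)] : Fintype.card (fixedField p k F) = p ^ k := by
  let := ZMod.algebra F p
  have hfin : Module.finrank (ZMod p) F = m := by
    have h := Module.card_eq_pow_finrank (K := ZMod p) (V := F)
    rw [ZMod.card, hF] at h
    exact (Nat.pow_right_injective hp.out.two_le h).symm
  refine le_antisymm ?_ ?_
  · have h : Fintype.card (fixedField p k F) - 1 ∣ p ^ k - 1 := by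
      rw [← FiniteField.forall_pow_eq_one_iff]
      intro x
      have hx : (x : fixedField p k F) ^ p ^ k = x :=
        Subtype.ext (by
          rw [SubmonoidClass.coe_pow]
          exact mem_fixedField.1 (x : fixedField p k F).2)
      have hpk : p ^ k = p ^ k - 1 + 1 := (Nat.sub_add_cancel (Nat.one_le_pow _ _ hp.out.pos)).symm
      rw [← Units.val_pow_eq_pow_val, Units.val_inj] at hx
      rw [hpk, pow_succ, mul_eq_right] at hx
      exact hx
    have h1 : 1 < p ^ k := Nat.one_lt_pow hk hp.out.one_lt
    have := Nat.le_of_dvd (by omega) h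
    omega
  · obtain ⟨φ⟩ := FiniteField.nonempty_algHom_of_finrank_dvd (F := ZMod p) (K := GaloisField p k)
      (L := F) (by rwa [GaloisField.finrank p hk, hfin])
    have hc : Nat.card (GaloisField p k) = p ^ k := GaloisField.card p k hk
    have : Fintype (GaloisField p k) := Fintype.ofFinite _
    rw [Nat.card_eq_fintype_card] at hc
    have hmem : ∀ x, φ x ∈ fixedField p k F := fun x => by
      rw [mem_fixedField, ← map_pow, ← hc, FiniteField.pow_card]
    rw [← hc]
    exact Fintype.card_le_of_injective (fun x => (⟨φ x, hmem x⟩ : fixedField p k F))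
      fun x y h => φ.injective (congrArg Subtype.val h)

end FixedField

/-! ### One-variable sums. -/

section PowerSum

variable {F K : Type*} [Field F] [NormedField K] {ω : F →*₀ K}

/-- Replacing x by yx multiplies the sum by ω(y) ^ N, so a nonzero sum forces y ^ N = 1. -/
lemma IsTeichmuller.card_sub_one_dvd_of_sum_pow_ne_zero [Finite F] (hω : IsTeichmuller ω)
    (E : Subfield F) [Fintype E] {N : ℕ} (h : ∑ x : E, ω (x : F) ^ N ≠ 0) :
    Fintype.card E - 1 ∣ N := by
  rw [← FiniteField.forall_pow_eq_one_iff]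
  intro y
  have hmul : ω ((y : E) : F) ^ N * ∑ x : E, ω (x : F) ^ N = ∑ x : E, ω (x : F) ^ N := by
    rw [Finset.mul_sum]
    refine Fintype.sum_bijective (fun x : E => (y : E) * x) y.mulLeft_bijective _ _ fun x => ?_
    rw [← mul_pow, ← map_mul, ← MulMemClass.coe_mul]
  have h1 := mul_right_cancel₀ h (hmul.trans (one_mul _).symm)
  rw [← map_pow, ← map_one ω] at h1
  have h2 := hω.injective h1
  exact Units.ext (Subtype.ext (by simpa using h2))

end PowerSum

section LocalBound

variable {p : ℕ} [hp : Fact p.Prime] {F K : Type*} [Field F] [Fintype F] [CharP F p]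
  [NormedField K] [NormedAlgebra ℚ_[p] K] {ω : F →*₀ K} {ζ : K}

lemma norm_sum_pow_mul_le (hω : IsTeichmuller ω) (hζ : IsPrimitiveRoot ζ p) {k : ℕ}
    (hk : k ≠ 0) [Fintype (fixedField p k F)]
    (hcard : Fintype.card (fixedField p k F) = p ^ k) {w : ℕ} (hw : w ≠ 0) (N : ℕ) :
    ‖∑ x : fixedField p k F, ω (x : F) ^ N‖ ^ w * ‖ζ - 1‖ ^ digitSum p N ≤
      ‖ζ - 1‖ ^ (k * (p - 1)) := by
  have := isUltrametricDist_of_padic p K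
  have hρ0 : 0 ≤ ‖ζ - 1‖ := norm_nonneg _
  have hρ1 : ‖ζ - 1‖ ≤ 1 := hζ.norm_sub_one_lt_one.le
  rcases Nat.eq_zero_or_pos N with rfl | hN
  -- Since 0 ^ 0 = 1, the sum is exactly p ^ k; its first power already suffices, and w ≥ 1.
  · simp only [pow_zero, Finset.sum_const, Finset.card_univ, hcard, nsmul_eq_mul, mul_one,
      digitSum_zero]
    rw [hζ.norm_prime_pow, ← pow_mul]
    exact pow_le_pow_of_le_one hρ0 hρ1 (Nat.le_mul_of_pos_right _ (Nat.pos_of_ne_zero hw))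
  · by_cases h : ∑ x : fixedField p k F, ω (x : F) ^ N = 0
    · rw [h, norm_zero, zero_pow hw, zero_mul]
      exact pow_nonneg hρ0 _
    · have hd := hω.card_sub_one_dvd_of_sum_pow_ne_zero _ h
      rw [hcard] at hd
      have h1 : ‖∑ x : fixedField p k F, ω (x : F) ^ N‖ ≤ 1 := by
        refine IsUltrametricDist.norm_sum_le_of_forall_le_of_nonneg zero_le_one fun x _ => ?_
        rw [norm_pow]
        exact pow_le_one₀ (norm_nonneg _) (norm_map_le_one _)
      refine (mul_le_of_le_one_left (pow_nonneg hρ0 _) (pow_le_one₀ (norm_nonneg _) h1)).trans ?_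
      exact pow_le_pow_of_le_one hρ0 hρ1 (mul_le_digitSum_of_dvd hp.out.one_lt hk hN hd)

lemma norm_sum_mulChar_mul_pow_mul_le (hω : IsTeichmuller ω) (hζ : IsPrimitiveRoot ζ p) {k : ℕ}
    (hk : k ≠ 0) [Fintype (fixedField p k F)]
    (hcard : Fintype.card (fixedField p k F) = p ^ k) {w : ℕ} (hw : w ≠ 0)
    {χ : MulChar (fixedField p k F) K} {e : ℕ} (he : IsTeichmullerExponent ω χ e) (m : ℕ) :
    ‖∑ x : fixedField p k F, χ x * ω (x : F) ^ m‖ ^ w *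
      ‖ζ - 1‖ ^ (digitSum p e + digitSum p m) ≤ ‖ζ - 1‖ ^ (k * (p - 1)) := by
  obtain ⟨he1, -, hχ⟩ := he
  have hterm : ∀ x : fixedField p k F, χ x * ω (x : F) ^ m = ω (x : F) ^ (e + m) := by
    intro x
    by_cases hx : x = 0
    -- Here e ≥ 1 is essential: the trivial character has exponent p ^ k - 1, not 0.
    · rw [hx, MulChar.map_zero, zero_mul, ZeroMemClass.coe_zero, map_zero, zero_pow (by omega)]
    · rw [hχ x hx, pow_add]
  simp_rw [hterm]
  refine le_trans (mul_le_mul_of_nonneg_left ?_ (pow_nonneg (norm_nonneg _) _))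
    (norm_sum_pow_mul_le hω hζ hk hcard hw (e + m))
  exact pow_le_pow_of_le_one (norm_nonneg _) hζ.norm_sub_one_lt_one.le
    (digitSum_add_le hp.out.one_lt e m)

end LocalBound

/-! ### Expansion over the monomials and the global bound. -/

lemma AddChar.map_sum_eq_prod_map {G M ι : Type*} [AddCommMonoid G] [CommMonoid M]
    (ψ : AddChar G M) (s : Finset ι) (g : ι → G) : ψ (∑ i ∈ s, g i) = ∏ i ∈ s, ψ (g i) := by
  classical
  induction s using Finset.induction_on with
  | empty => simp
  | insert i s hi ih =>
    rw [Finset.sum_insert hi, Finset.prod_insert hi, AddChar.map_add_eq_mul, ih]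

section MainBound

variable {p : ℕ} [hp : Fact p.Prime]

lemma sum_digitSum_le_pWeight_mul {n : ℕ} {F : Type*} [CommSemiring F]
    (f : MvPolynomial (Fin n) F) (κ : f.support → ℕ) :
    ∑ i, digitSum p (∑ u : f.support, u.1 i * κ u) ≤
      pWeight p f * ∑ u : f.support, digitSum p (κ u) := by
  have hp1 := hp.out.one_lt
  calc ∑ i, digitSum p (∑ u : f.support, u.1 i * κ u)
      ≤ ∑ i, ∑ u : f.support, digitSum p (u.1 i) * digitSum p (κ u) :=
        Finset.sum_le_sum fun i _ => (digitSum_sum_le hp1 _ _).trans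
          (Finset.sum_le_sum fun u _ => digitSum_mul_le hp1 _ _)
    _ = ∑ u : f.support, (∑ i, digitSum p (u.1 i)) * digitSum p (κ u) := by
        rw [Finset.sum_comm]
        simp_rw [Finset.sum_mul]
    _ ≤ ∑ u : f.support, pWeight p f * digitSum p (κ u) :=
        Finset.sum_le_sum fun u _ => Nat.mul_le_mul_right _
          (Finset.le_sup (f := fun u : Fin n →₀ ℕ => ∑ i, digitSum p (u i)) u.2)
    _ = _ := by rw [Finset.mul_sum]

variable {F K : Type*} [Field F] [NormedField K]

lemma sum_prod_mul_addChar_eval {ω : F →*₀ K} {ψ : AddChar F K} {Q : ℕ} {c : ℕ → K}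
    (hc : ∀ x, ψ x = ∑ k ∈ Finset.range Q, c k * ω x ^ k) {n : ℕ} (f : MvPolynomial (Fin n) F)
    {α : Fin n → Type*} [∀ i, Fintype (α i)] (ι : ∀ i, α i → F) (φ : ∀ i, α i → K) :
    ∑ x : (∀ i, α i), (∏ i, φ i (x i)) * ψ (MvPolynomial.eval (fun i => ι i (x i)) f) =
      ∑ κ ∈ Fintype.piFinset fun _ : f.support => Finset.range Q,
        (∏ u : f.support, c (κ u) * ω (f.coeff u) ^ κ u) *
          ∏ i, ∑ y : α i, φ i y * ω (ι i y) ^ (∑ u : f.support, u.1 i * κ u) := by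
  classical
  have hψ : ∀ x : (∀ i, α i), ψ (MvPolynomial.eval (fun i => ι i (x i)) f) =
      ∑ κ ∈ Fintype.piFinset fun _ : f.support => Finset.range Q,
        (∏ u : f.support, c (κ u) * ω (f.coeff u) ^ κ u) *
          ∏ i, ω (ι i (x i)) ^ (∑ u : f.support, u.1 i * κ u) := by
    intro x
    rw [MvPolynomial.eval_eq', ← Finset.sum_coe_sort, AddChar.map_sum_eq_prod_map]
    simp_rw [hc]
    rw [Finset.prod_univ_sum]
    refine Finset.sum_congr rfl fun κ _ => ?_
    simp_rw [← Finset.prod_pow_eq_pow_sum]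
    rw [Finset.prod_comm, ← Finset.prod_mul_distrib]
    refine Finset.prod_congr rfl fun u _ => ?_
    simp_rw [map_mul, map_prod, map_pow, mul_pow, ← Finset.prod_pow, pow_mul, mul_assoc]
  simp_rw [hψ, Finset.mul_sum]
  rw [Finset.sum_comm]
  refine Finset.sum_congr rfl fun κ _ => ?_
  rw [Finset.prod_univ_sum, Fintype.piFinset_univ, Finset.mul_sum]
  refine Finset.sum_congr rfl fun x _ => ?_
  rw [Finset.prod_mul_distrib (f := fun i => φ i (x i))]
  ring

variable [Fintype F] [Algebra (ZMod p) F] [NormedAlgebra ℚ_[p] K] {ω : F →*₀ K} {ζ : K}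

/-- The weights φ and exponents E, A are left free so that twisted and untwisted variables are
treated alike. -/
lemma norm_weighted_sum_pow_mul_le (hω : IsTeichmuller ω) (hζ : IsPrimitiveRoot ζ p)
    {ψ : AddChar F K} (hψ : ψ ≠ 1) {n : ℕ} (f : MvPolynomial (Fin n) F)
    {α : Fin n → Type*} [∀ i, Fintype (α i)] (ι : ∀ i, α i → F) (φ : ∀ i, α i → K)
    (E A : Fin n → ℕ)
    (h : ∀ i m, ‖∑ y : α i, φ i y * ω (ι i y) ^ m‖ ^ pWeight p f *
      ‖ζ - 1‖ ^ (E i + digitSum p m) ≤ ‖ζ - 1‖ ^ A i) :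
    ‖∑ x : (∀ i, α i), (∏ i, φ i (x i)) * ψ (MvPolynomial.eval (fun i => ι i (x i)) f)‖ ^
      pWeight p f * ‖ζ - 1‖ ^ (∑ i, E i) ≤ ‖ζ - 1‖ ^ (∑ i, A i) := by
  have := isUltrametricDist_of_padic p K
  have hρ0 : 0 ≤ ‖ζ - 1‖ := norm_nonneg _
  have hρ1 : ‖ζ - 1‖ ≤ 1 := hζ.norm_sub_one_lt_one.le
  obtain ⟨c, hc, hcn⟩ := exists_expansion_addChar hω hζ hψ
  rw [sum_prod_mul_addChar_eval hc f ι φ]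
  set w := pWeight p f with hw
  set W : (f.support → ℕ) → Fin n → K := fun κ i =>
    ∑ y : α i, φ i y * ω (ι i y) ^ (∑ u : f.support, u.1 i * κ u) with hW
  obtain ⟨κ, hκ, hle⟩ := IsUltrametricDist.exists_norm_finsetSum_le
    (Fintype.piFinset fun _ : f.support => Finset.range (Fintype.card F))
    (fun κ => (∏ u : f.support, c (κ u) * ω (f.coeff u) ^ κ u) * ∏ i, W κ i)
  have hκ' := hκ (Fintype.piFinset_nonempty.2 fun _ =>
    Finset.nonempty_range_iff.2 Fintype.card_ne_zero)
  rw [Fintype.mem_piFinset] at hκ'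
  have hcoef : ‖∏ u : f.support, c (κ u) * ω (f.coeff u) ^ κ u‖ ^ w ≤
      ‖ζ - 1‖ ^ ∑ i, digitSum p (∑ u : f.support, u.1 i * κ u) := by
    calc ‖∏ u : f.support, c (κ u) * ω (f.coeff u) ^ κ u‖ ^ w
        ≤ (∏ u : f.support, ‖ζ - 1‖ ^ digitSum p (κ u)) ^ w := by
          rw [norm_prod]
          refine pow_le_pow_left₀ (Finset.prod_nonneg fun _ _ => norm_nonneg _)
            (Finset.prod_le_prod (fun _ _ => norm_nonneg _) fun u _ => ?_) _
          rw [norm_mul, norm_pow]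
          exact (mul_le_of_le_one_right (norm_nonneg _)
            (pow_le_one₀ (norm_nonneg _) (norm_map_le_one _))).trans (hcn _ (hκ' u))
      _ = ‖ζ - 1‖ ^ (w * ∑ u : f.support, digitSum p (κ u)) := by
          rw [Finset.prod_pow_eq_pow_sum, ← pow_mul, mul_comm]
      _ ≤ _ := pow_le_pow_of_le_one hρ0 hρ1 (sum_digitSum_le_pWeight_mul f κ)
  refine (mul_le_mul_of_nonneg_right (pow_le_pow_left₀ (norm_nonneg _) hle _)
    (pow_nonneg hρ0 _)).trans ?_
  calc ‖(∏ u : f.support, c (κ u) * ω (f.coeff u) ^ κ u) * ∏ i, W κ i‖ ^ w *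
        ‖ζ - 1‖ ^ ∑ i, E i
      = ‖∏ u : f.support, c (κ u) * ω (f.coeff u) ^ κ u‖ ^ w *
        ((∏ i, ‖W κ i‖ ^ w) * ‖ζ - 1‖ ^ ∑ i, E i) := by
        rw [norm_mul, mul_pow, norm_prod (f := W κ), Finset.prod_pow, mul_assoc]
    _ ≤ ‖ζ - 1‖ ^ (∑ i, digitSum p (∑ u : f.support, u.1 i * κ u)) *
        ((∏ i, ‖W κ i‖ ^ w) * ‖ζ - 1‖ ^ ∑ i, E i) :=
        mul_le_mul_of_nonneg_right hcoef (mul_nonneg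
          (Finset.prod_nonneg fun _ _ => pow_nonneg (norm_nonneg _) _) (pow_nonneg hρ0 _))
    -- The bound on the coefficient is shared out among the variables, each receiving the factor its
    -- local estimate needs.
    _ = ∏ i, (‖W κ i‖ ^ w * ‖ζ - 1‖ ^ (E i + digitSum p (∑ u : f.support, u.1 i * κ u))) := by
        rw [Finset.prod_mul_distrib, Finset.prod_pow_eq_pow_sum, Finset.sum_add_distrib, pow_add]
        ring
    _ ≤ ∏ i, ‖ζ - 1‖ ^ A i :=
        Finset.prod_le_prod (fun _ _ => mul_nonneg (pow_nonneg (norm_nonneg _) _)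
          (pow_nonneg hρ0 _)) fun i _ => h i _
    _ = _ := Finset.prod_pow_eq_pow_sum _ _ _

end MainBound

/-! ### A Teichmüller character over a larger field. -/

section TeichmullerExistence

open IsLocalRing

variable {p : ℕ} [hp : Fact p.Prime]

/-- Reduction is injective on the roots of t ^ Q = t, and L contains a primitive (Q - 1)-th root of
unity. So X ^ Q - X splits in the residue field, F embeds there, and unique lifting makes the lift
multiplicative. -/
lemma exists_isTeichmuller (F : Type*) [Field F] [Fintype F] [CharP F p] (L : Type*)
    [NormedField L] [NormedAlgebra ℚ_[p] L] [IsAlgClosed L] :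
    ∃ ω : F →*₀ L, IsTeichmuller ω := by
  have := isUltrametricDist_of_padic p L
  have : CharZero L := charZero_of_injective_algebraMap (algebraMap ℚ_[p] L).injective
  let V : ValuationSubring L := (NormedField.valuation (K := L)).valuationSubring
  have hV : ∀ x : L, x ∈ V ↔ ‖x‖ ≤ 1 := fun x => by
    rw [Valuation.mem_valuationSubring_iff, ← NNReal.coe_le_coe]
    rfl
  have hres : ∀ x : V, residue V x = 0 ↔ ‖(x : L)‖ < 1 := by
    intro x
    rw [residue_eq_zero_iff, mem_maximalIdeal, mem_nonunits_iff]
    constructor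
    · intro hx
      refine lt_of_le_of_ne ((hV _).1 x.2) fun h1 => hx ?_
      have hx0 : (x : L) ≠ 0 := norm_ne_zero_iff.1 (by rw [h1]; exact one_ne_zero)
      refine IsUnit.of_mul_eq_one ⟨(x : L)⁻¹, (hV _).2 (by rw [norm_inv, h1, inv_one])⟩ ?_
      exact Subtype.ext (mul_inv_cancel₀ hx0)
    · rintro hx ⟨u, rfl⟩
      have h1 : ((u : V) : L) * ((u⁻¹ : Vˣ) : V) = 1 :=
        congrArg Subtype.val (Units.mul_inv u)
      have h2 := congrArg norm h1
      rw [norm_mul, norm_one] at h2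
      have h3 : ‖(((u⁻¹ : Vˣ) : V) : L)‖ ≤ 1 := (hV _).1 ((u⁻¹ : Vˣ) : V).2
      exact absurd h2 (mul_lt_one_of_nonneg_of_lt_one_left (norm_nonneg _) hx h3).ne
  have hpk : (p : ResidueField V) = 0 := by
    rw [← map_natCast (residue V), hres]
    have : ((p : V) : L) = p := by simp
    rw [this, norm_prime_eq p L]
    exact inv_lt_one_of_one_lt₀ (by exact_mod_cast hp.out.one_lt)
  have : CharP (ResidueField V) p := (CharP.charP_iff_prime_eq_zero hp.out).2 hpk
  let : Algebra (ZMod p) F := ZMod.algebra F p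
  let : Algebra (ZMod p) (ResidueField V) := ZMod.algebra _ p
  set Q := Fintype.card F with hQ
  have hQ1 : 1 < Q := Fintype.one_lt_card
  have hQk : (Q : ResidueField V) = 0 := by
    have h : Q = p ^ Module.finrank (ZMod p) F := by
      rw [hQ, Module.card_eq_pow_finrank (K := ZMod p), ZMod.card]
    rw [h, Nat.cast_pow, hpk, zero_pow Module.finrank_pos.ne']
  -- If s ≠ t, cancelling s - t in s ^ Q - t ^ Q = s - t leaves a geometric sum equal to 1 whose
  -- reduction is a multiple of Q = 0.
  have huniq : ∀ s t : V, s ^ Q = s → t ^ Q = t → residue V s = residue V t → s = t := by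
    intro s t hs ht hst
    by_contra hne
    have h1 := (Commute.all s t).geom_sum₂_mul Q
    rw [hs, ht] at h1
    have h2 := mul_right_cancel₀ (sub_ne_zero.2 hne) (h1.trans (one_mul _).symm)
    have h3 := congrArg (residue V) h2
    simp only [map_sum, map_mul, map_pow, map_one, hst] at h3
    rw [geom_sum₂_self, hQk, zero_mul] at h3
    exact zero_ne_one h3
  have hN0 : NeZero (Q - 1) := ⟨by omega⟩
  obtain ⟨η, hη⟩ := HasEnoughRootsOfUnity.exists_primitiveRoot L (Q - 1)
  have hηV : η ∈ V := (hV _).2 (norm_eq_one_of_pow_eq_self (by omega) hη.pow_eq_one).le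
  let y : V := ⟨η, hηV⟩
  have hy : y ^ (Q - 1) = 1 := Subtype.ext hη.pow_eq_one
  have hfix : ∀ i, (y ^ i) ^ Q = y ^ i := by
    intro i
    have : Q = Q - 1 + 1 := by omega
    rw [this, pow_succ, ← pow_mul, mul_comm i, pow_mul, hy, one_pow, one_mul]
  have hyprim : IsPrimitiveRoot (residue V y) (Q - 1) := by
    refine ⟨by rw [← map_pow, hy, map_one], fun j hj => ?_⟩
    rw [← map_pow, ← map_one (residue V)] at hj
    have h1 := huniq _ _ (hfix j) (one_pow _) hj
    exact hη.dvd_of_pow_eq_one j (congrArg Subtype.val h1)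
  have hsplit : ((Polynomial.X ^ Q - Polynomial.X : Polynomial (ZMod p)).map
      (algebraMap (ZMod p) (ResidueField V))).Splits := by
    have e : (Polynomial.X ^ Q - Polynomial.X : Polynomial (ZMod p)).map
        (algebraMap (ZMod p) (ResidueField V)) =
        Polynomial.X * (Polynomial.X ^ (Q - 1) - 1) := by
      rw [mul_sub, ← pow_succ', Nat.sub_add_cancel hQ1.le]
      simp
    rw [e]
    exact Polynomial.Splits.X.mul (Polynomial.X_pow_sub_one_splits hyprim)
  let e : F →ₐ[ZMod p] ResidueField V := Polynomial.IsSplittingField.lift F _ hsplit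
  have hex : ∀ x : F, ∃ t : V, t ^ Q = t ∧ residue V t = e x := by
    intro x
    rcases eq_or_ne x 0 with rfl | hx
    · exact ⟨0, zero_pow (by omega), by simp⟩
    · have h1 : e x ^ (Q - 1) = 1 := by
        rw [← map_pow, FiniteField.pow_card_sub_one_eq_one x hx, map_one]
      obtain ⟨i, -, hi⟩ := hyprim.eq_pow_of_pow_eq_one h1
      exact ⟨y ^ i, hfix i, by rw [map_pow, hi]⟩
  choose τ hτ hτe using hex
  refine ⟨{ toFun := fun x => (τ x : L), map_zero' := ?_, map_one' := ?_, map_mul' := ?_ }, ?_⟩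
  · have : τ 0 = 0 := huniq _ _ (hτ 0) (zero_pow (by omega)) (by rw [hτe]; simp)
    rw [this]; rfl
  · have : τ 1 = 1 := huniq _ _ (hτ 1) (one_pow _) (by rw [hτe]; simp)
    rw [this]; rfl
  · intro a b
    have : τ (a * b) = τ a * τ b :=
      huniq _ _ (hτ _) (by rw [mul_pow, hτ, hτ]) (by rw [hτe, map_mul, map_mul, hτe, hτe])
    rw [this]; rfl
  · intro a b
    refine (hres (τ (a + b) - (τ a + τ b))).1 ?_
    rw [map_sub, map_add, hτe, hτe, hτe, map_add, sub_self]

end TeichmullerExistence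

section Extension

universe u

open UniformSpace

/-- K is completed first so that the spectral norm on the algebraic closure is multiplicative. -/
lemma exists_isAlgClosed_normed_extension (p : ℕ) [hp : Fact p.Prime] (K : Type u) [NormedField K]
    [NormedAlgebra ℚ_[p] K] :
    ∃ (L : Type u) (_ : NormedField L) (_ : NormedAlgebra ℚ_[p] L) (_ : IsAlgClosed L)
      (i : K →+* L), ∀ x, ‖i x‖ = ‖x‖ := by
  let C := Completion K
  have : IsUltrametricDist C := isUltrametricDist_of_padic p C
  let : NontriviallyNormedField C := NontriviallyNormedField.ofNormNeOne
    ⟨(p : C), by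
      have h := norm_prime_eq p C
      have h0 : (p : ℝ)⁻¹ < 1 := inv_lt_one_of_one_lt₀ (by exact_mod_cast hp.out.one_lt)
      have h1 : 0 < (p : ℝ)⁻¹ := inv_pos.2 (by exact_mod_cast hp.out.pos)
      exact ⟨norm_ne_zero_iff.1 (by rw [h]; exact h1.ne'), by rw [h]; exact h0.ne⟩⟩
  let L := AlgebraicClosure C
  let inst : NormedField L := spectralNorm.normedField C L
  have hnorm : ∀ x : C, ‖algebraMap C L x‖ = ‖x‖ := fun x => spectralNorm_extends x
  let alg : Algebra ℚ_[p] L := ((algebraMap C L).comp (algebraMap ℚ_[p] C)).toAlgebra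
  refine ⟨L, inst, { alg with norm_smul_le := fun r x => ?_ }, inferInstance,
    (algebraMap C L).comp Completion.coeRingHom, fun x => ?_⟩
  · change ‖algebraMap C L (algebraMap ℚ_[p] C r) * x‖ ≤ _
    rw [norm_mul, hnorm, norm_algebraMap']
  · change ‖algebraMap C L (x : C)‖ = _
    rw [hnorm, Completion.norm_coe]

end Extension

/-! ### From norms to ord_q. -/

section OrdBound

variable {p : ℕ} [hp : Fact p.Prime] {K : Type*} [NormedField K] [NormedAlgebra ℚ_[p] K] {ζ : K}

lemma le_ordq_of_norm_pow_mul_le (hζ : IsPrimitiveRoot ζ p) {a w D E : ℕ} (ha : 1 ≤ a)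
    (hw : w ≠ 0) {S : K} (h : ‖S‖ ^ w * ‖ζ - 1‖ ^ E ≤ ‖ζ - 1‖ ^ (a * D * (p - 1))) :
    (((1 / (w : ℝ)) * ((D : ℝ) - (1 / ((a : ℝ) * ((p : ℝ) - 1))) * (E : ℝ)) : ℝ) : WithTop ℝ) ≤
      ordq (p ^ a) S := by
  rw [ordq]
  split_ifs with hS
  · exact le_top
  rw [WithTop.coe_le_coe]
  have hs : 0 < ‖S‖ := norm_pos_iff.2 hS
  have hρ : 0 < ‖ζ - 1‖ := hζ.norm_sub_one_pos
  have hp1 : (1 : ℝ) < p := by exact_mod_cast hp.out.one_lt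
  have hP : (0 : ℝ) < (p : ℝ) - 1 := by linarith
  have hlp : 0 < Real.log p := Real.log_pos hp1
  have ha0 : (0 : ℝ) < a := by exact_mod_cast ha
  have hw0 : (0 : ℝ) < w := by exact_mod_cast Nat.pos_of_ne_zero hw
  have hcast : ((p - 1 : ℕ) : ℝ) = (p : ℝ) - 1 := by
    rw [Nat.cast_sub hp.out.one_le, Nat.cast_one]
  have hlρ : ((p : ℝ) - 1) * Real.log ‖ζ - 1‖ = -Real.log p := by
    rw [← hcast, ← Real.log_pow, hζ.norm_sub_one_pow_of_padic, Real.log_inv]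
  have hlog := Real.log_le_log (mul_pos (pow_pos hs w) (pow_pos hρ E)) h
  rw [Real.log_mul (pow_pos hs w).ne' (pow_pos hρ E).ne', Real.log_pow, Real.log_pow,
    Real.log_pow, Nat.cast_mul, Nat.cast_mul, hcast, mul_assoc ((a : ℝ) * D), hlρ] at hlog
  have hρeq : Real.log ‖ζ - 1‖ = -(Real.log p / ((p : ℝ) - 1)) := by
    field_simp
    linarith
  rw [hρeq] at hlog
  rw [Real.logb, Nat.cast_pow, Real.log_pow, ← neg_div, le_div_iff₀ (mul_pos ha0 hlp)]
  have e : 1 / (w : ℝ) * ((D : ℝ) - 1 / ((a : ℝ) * ((p : ℝ) - 1)) * E) * (a * Real.log p) =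
      (a * D * Real.log p - E * (Real.log p / ((p : ℝ) - 1))) / w := by
    field_simp
  rw [e, div_le_iff₀ hw0]
  linarith

end OrdBound

/-! ### The two character sums. -/

section CharacterSums

variable {p : ℕ} [hp : Fact p.Prime] {a n : ℕ} {d : Fin n → ℕ} {F K : Type*} [Field F] [Fintype F]
  [CharP F p] [NormedField K]

open scoped Classical in
-- The restriction x_i ≠ 0 is automatic, as every χ_i, even the trivial one, vanishes at 0.
lemma mixedSum_eq_sum_prod {r : ℕ} (hr : r ≤ n)
    (χ : (i : Fin r) → MulChar (fixedField p (a * d (Fin.castLE hr i)) F) K)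
    (ψ : AddChar F K) (f : MvPolynomial (Fin n) F) :
    mixedSum hr d χ ψ f = ∑ x : ((i : Fin n) → fixedField p (a * d i) F),
      (∏ i : Fin n, if h : (i : ℕ) < r then χ ⟨i, h⟩ (x i) else 1) *
        ψ (MvPolynomial.eval (fun i => (x i : F)) f) := by
  rw [mixedSum, Finset.sum_filter]
  refine Finset.sum_congr rfl fun x _ => ?_
  have hprod : ∏ i : Fin r, χ i (x (Fin.castLE hr i)) =
      ∏ i : Fin n, if h : (i : ℕ) < r then χ ⟨i, h⟩ (x i) else 1 := by
    refine Fintype.prod_of_injective (Fin.castLE hr) (Fin.castLE_injective hr) _ _ ?_ ?_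
    · intro i hi
      refine dif_neg fun h => hi ⟨⟨i, h⟩, rfl⟩
    · intro i
      rw [dif_pos (show ((Fin.castLE hr i : Fin n) : ℕ) < r from i.2)]
      rfl
  split_ifs with h
  · rw [hprod]
  · push Not at h
    obtain ⟨i, hi⟩ := h
    rw [← hprod, Finset.prod_eq_zero (Finset.mem_univ i) (by rw [hi, MulChar.map_zero]),
      zero_mul]

lemma card_fixedField_mul (ha : 1 ≤ a) (hd : ∀ i, 1 ≤ d i)
    (hF : Fintype.card F = (p ^ a) ^ (Finset.univ.lcm d)) (i : Fin n)
    [Fintype (fixedField p (a * d i) F)] :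
    Fintype.card (fixedField p (a * d i) F) = p ^ (a * d i) :=
  card_fixedField (Nat.mul_ne_zero (by omega) (by have := hd i; omega)) (by rw [hF, ← pow_mul])
    (Nat.mul_dvd_mul_left a (Finset.dvd_lcm (Finset.mem_univ i)))

variable [NormedAlgebra ℚ_[p] K] {ω : F →*₀ K} {ζ : K}

lemma norm_mixedSum_pow_mul_le (ha : 1 ≤ a) (hd : ∀ i, 1 ≤ d i)
    (hF : Fintype.card F = (p ^ a) ^ (Finset.univ.lcm d)) (hζ : IsPrimitiveRoot ζ p)
    {ψ : AddChar F K} (hψ : ψ ≠ 1) {f : MvPolynomial (Fin n) F} (hf : pWeight p f ≠ 0)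
    {r : ℕ} (hr : r ≤ n) (hω : IsTeichmuller ω)
    {χ : (i : Fin r) → MulChar (fixedField p (a * d (Fin.castLE hr i)) F) K}
    {e : Fin r → ℕ} (he : ∀ i, IsTeichmullerExponent ω (χ i) (e i)) :
    ‖mixedSum hr d χ ψ f‖ ^ pWeight p f * ‖ζ - 1‖ ^ (∑ i, digitSum p (e i)) ≤
      ‖ζ - 1‖ ^ (a * (∑ i, d i) * (p - 1)) := by
  classical
  let := ZMod.algebra F p
  have hE : ∑ i, digitSum p (e i) =
      ∑ i : Fin n, if h : (i : ℕ) < r then digitSum p (e ⟨i, h⟩) else 0 := by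
    refine Fintype.sum_of_injective (Fin.castLE hr) (Fin.castLE_injective hr) _ _ ?_ ?_
    · intro i hi
      refine dif_neg fun h => hi ⟨⟨i, h⟩, rfl⟩
    · intro i
      rw [dif_pos (show ((Fin.castLE hr i : Fin n) : ℕ) < r from i.2)]
      rfl
  rw [mixedSum_eq_sum_prod, hE, Finset.mul_sum, Finset.sum_mul]
  refine norm_weighted_sum_pow_mul_le hω hζ hψ f
    (α := fun i => fixedField p (a * d i) F) (fun i y => (y : F))
    (fun i y => if h : (i : ℕ) < r then χ ⟨i, h⟩ y else 1) _ _ fun i m => ?_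
  have hk : a * d i ≠ 0 := Nat.mul_ne_zero (by omega) (by have := hd i; omega)
  have hcard := card_fixedField_mul ha hd hF i
  by_cases h : (i : ℕ) < r
  · simp only [dif_pos h]
    exact norm_sum_mulChar_mul_pow_mul_le hω hζ hk hcard hf (he ⟨i, h⟩) m
  · simp only [dif_neg h, one_mul, zero_add]
    exact norm_sum_pow_mul_le hω hζ hk hcard hf m

lemma norm_partialSum_pow_le (ha : 1 ≤ a) (hd : ∀ i, 1 ≤ d i)
    (hF : Fintype.card F = (p ^ a) ^ (Finset.univ.lcm d)) (hζ : IsPrimitiveRoot ζ p)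
    {ψ : AddChar F K} (hψ : ψ ≠ 1) {f : MvPolynomial (Fin n) F} (hf : pWeight p f ≠ 0) :
    ‖partialSum p a d ψ f‖ ^ pWeight p f ≤ ‖ζ - 1‖ ^ (a * (∑ i, d i) * (p - 1)) := by
  classical
  let := ZMod.algebra F p
  -- K need not contain the values of a Teichmüller character, so this is not the case r = 0 of the
  -- twisted bound; the estimate is made in L.
  obtain ⟨L, _, _, _, ι, hι⟩ := exists_isAlgClosed_normed_extension p K
  obtain ⟨ω, hω⟩ := exists_isTeichmuller (p := p) F L
  have hζL : IsPrimitiveRoot (ι ζ) p := hζ.map_of_injective ι.injective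
  have hζn : ‖ι ζ - 1‖ = ‖ζ - 1‖ := by rw [← hι, map_sub, map_one]
  let ψL : AddChar F L := (ι : K →* L).compAddChar ψ
  have hψL : ψL ≠ 1 := by
    obtain ⟨x, hx⟩ := AddChar.ne_one_iff.1 hψ
    refine AddChar.ne_one_iff.2 ⟨x, fun h => hx (ι.injective ?_)⟩
    rw [map_one]
    exact h
  have hS : ι (partialSum p a d ψ f) = ∑ x : ((i : Fin n) → fixedField p (a * d i) F),
      (∏ _i : Fin n, (1 : L)) * ψL (MvPolynomial.eval (fun i => (x i : F)) f) := by
    rw [partialSum, map_sum]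
    refine Finset.sum_congr rfl fun x _ => ?_
    rw [Finset.prod_const_one, one_mul]
    rfl
  have key := norm_weighted_sum_pow_mul_le hω hζL hψL f
    (α := fun i => fixedField p (a * d i) F) (fun i y => (y : F)) (fun _ _ => 1)
    (fun _ => 0) (fun i => a * d i * (p - 1)) fun i m => by
      have hk : a * d i ≠ 0 := Nat.mul_ne_zero (by omega) (by have := hd i; omega)
      simp only [one_mul, zero_add]
      exact norm_sum_pow_mul_le hω hζL hk (card_fixedField_mul ha hd hF i) hf m
  rw [← hS, hι, hζn, Finset.sum_const_zero, pow_zero, mul_one] at key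
  rwa [Finset.mul_sum, Finset.sum_mul]

end CharacterSums

theorem theorem4p1 (p : ℕ) [Fact p.Prime] (a : ℕ) (ha : 1 ≤ a) {n : ℕ} (d : Fin n → ℕ)
    (hd : ∀ i, 1 ≤ d i)
    {F : Type*} [Field F] [Fintype F] [CharP F p]
    (hF : Fintype.card F = (p ^ a) ^ (Finset.univ.lcm d))
    {K : Type*} [NormedField K] [NormedAlgebra ℚ_[p] K]
    (ψ : AddChar F K) (hψ : ψ ≠ 1)
    (f : MvPolynomial (Fin n) F) (hf : pWeight p f ≠ 0) :
    (∀ (r : ℕ) (hr : r ≤ n) (ω : F →*₀ K), IsTeichmuller ω →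
      ∀ (χ : (i : Fin r) → MulChar (fixedField p (a * d (Fin.castLE hr i)) F) K)
        (e : Fin r → ℕ), (∀ i, IsTeichmullerExponent ω (χ i) (e i)) →
        (((1 / (pWeight p f : ℝ)) * ((∑ i, (d i : ℝ)) -
            (1 / ((a : ℝ) * ((p : ℝ) - 1))) * ∑ i, (digitSum p (e i) : ℝ)) : ℝ) : WithTop ℝ)
          ≤ ordq (p ^ a) (mixedSum hr d χ ψ f)) ∧
    (((∑ i, (d i : ℝ)) / (pWeight p f : ℝ) : ℝ) : WithTop ℝ)
      ≤ ordq (p ^ a) (partialSum p a d ψ f) := by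
  have hζ : ∃ ζ : K, IsPrimitiveRoot ζ p := by
    let := ZMod.algebra F p
    exact exists_isPrimitiveRoot_of_addChar hψ
  obtain ⟨ζ, hζ⟩ := hζ
  refine ⟨fun r hr ω hω χ e he => ?_, ?_⟩
  · have h := le_ordq_of_norm_pow_mul_le hζ ha hf
      (norm_mixedSum_pow_mul_le ha hd hF hζ hψ hf hr hω he)
    rwa [Nat.cast_sum, Nat.cast_sum] at h
  · have h := le_ordq_of_norm_pow_mul_le (E := 0) hζ ha hf (S := partialSum p a d ψ f)
      (by rw [pow_zero, mul_one]; exact norm_partialSum_pow_le ha hd hF hζ hψ hf)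
    rwa [Nat.cast_zero, mul_zero, sub_zero, Nat.cast_sum, one_div_mul_eq_div] at h
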